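/- **Setting.** Let $\mathcal G=(\mathcal I,\mathcal E)$ be a connected undirected graph with buses $\mathcal I=\{1,\dots,n\}$ and $m$ lines, with incidence matrix $D\in\mathbb R^{m\times n}$ for an arbitrary orientation, inertias $M_i\ge 0$ (at least one positive), damping coefficients $E_i>0$, and line susceptances $b_e>0$, $Y_b=\mathrm{diag}(b_e)$. Let $\mathcal I_\omega\subseteq\mathcal I_u\subseteq\mathcal I$, let $\underline\omega_i<\bar\omega_i$ and $d_i>0$ for $i\in\mathcal I_\omega$, let $c_i,\epsilon_i,\tau_i>0$ and $\kappa_i\ge0$ for $i\in\mathcal I_u$, and let $T>0$. Put $\mathbb A=\{u\in\mathbb R^n: u_i=0 \text{ for } i\notin\mathcal I_u\}$. The linearized model for the state $x=(\lambda,\omega,\alpha)\in\mathbb R^{m+2n}$ is $$\dot\lambda=D\omega,\qquad M\dot\omega=-E\omega-D^{\top}Y_b\lambda+p+\alpha,\qquad \kappa_i\dot\alpha_i=-\tfrac1{\tau_i}\alpha_i-\omega_i+u_i\ (i\in\mathcal I_u),\qquad 0=-\alpha_i\ (i\notin\mathcal I_u),$$ written compactly as $\tilde G\dot x=\tilde A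 x+\tilde B_1p+\tilde B_2u$ (the $i$th row of the input block of $\tilde B_2$ is zero for $i\notin \mathcal I_u$). Here $\kappa_i=1$ and $\kappa_i=M_i$ are both allowed. Let $N\ge 2$ and let $F,A\in\mathbb R^{(m+2n)\times(m+2n)}$, $B_1,B_2\in\mathbb R^{(m+2n)\times n}$. For $z=(p(1),\dots,p(N),x^0)\in\mathbb R^{(N+2)n+m}$, where $p(k)\in\mathbb R^n$ is the forecasted power injection and $x^0=(\lambda^0,\omega^0,\alpha^0)\in\mathbb R^{m+2n}$ the sampled state, let $\mathbf R(z)$ be the quadratic program over $X=(x(1),\dots,x(N))$ with $x(k)=(\lambda(k),\omega(k),\alpha(k))\in\mathbb R^{m+2n}$, $u\in\mathbb R^n$, and $S=(s_i(k))_{i\in\mathcal I_\omega,\,1\le k\le N}$: $$\min_{X,u,S}\ \sum_{k=1}^N\Big(\sum_{i\in\mathcal I_u}c_i\alpha_i(k)^2+\sum_{i\in\mathcal I_\omega}d_is_i(k)^2\Big)$$ subject to $Fx(k+1)=Ax(k)+B_1p(k)+B_2u$ for $1\le k\le N-1$; $u\in\mathbb A$; $x(1)=x^0$; $\underline\omega_i-s_i(k)\le\omega_i(k)\le\bar\omega_i+s_i(k)$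 for $i\in\mathcal I_\omega$, $1\le k\le N$; and $|u_i|\le\epsilon_i|\alpha^0_i|$ for $i\in\mathcal I_u$. **Proposition.** Suppose that $F$ is invertible and that at least one of the following holds: (a) backward Euler: $F=\tilde G-T\tilde A$ and $B_2=T\tilde B_2$ (with $A$, $B_1$ arbitrary); (b) forward Euler: $F=\tilde G$ and $B_2=T\tilde B_2$ (with $A$, $B_1$ arbitrary); (c) any other choice of $F,A,B_1,B_2$ (for example the impulse-invariant discretization) for which the only $u\in\mathbb A$ whose response under $Fx(k+1)=Ax(k)+B_2u$, $x(1)=0$, has $\alpha_i(k)=0$ for all $i\in\mathcal I_u$, $1\le k\le N$, is $u=0$. Then for every $z\in\mathbb R^{(N+2)n+m}$ the problem $\mathbf R(z)$ has a unique optimal solution $(\hat X^*,\hat u^*,S^*)$. Moreover $z\mapsto\hat u^*(z)$ is continuous and piecewise affine: there are $l\in\mathbb N$ and matrices and vectors $H_\xi,h_\xi,K_\xi,k_\xi$ ($1\le\xi\le l$) of suitable dimensions such that the polyhedra $\{y: H_\xi y\le h_\xi\}$ cover $\mathbb R^{(N+2)n+m}$ and $\hat u^*(z)=K_\xi z+k_\xi$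 whenever $H_\xi z\le h_\xi$. As a consequence, $\hat u^*$ is globally Lipschitz in $z$ for the Euclidean norms, with Lipschitz constant $\max_\xi\|K_\xi\|$ ($\|\cdot\|$ the induced 2-norm). -/

import Mathlib

open scoped Matrix NNReal Matrix.Norms.L2Operator

noncomputable section

/-- A power network: a connected undirected graph with `n` buses and `m` lines (enumerated by
`edge`), an arbitrary orientation of the lines, inertias `M i ≥ 0` (not all zero), damping
coefficients `E i > 0` and line susceptances `b e > 0`. -/
structure PowerNetwork (n m : ℕ) where
  graph : SimpleGraph (Fin n)
  connected : graph.Connected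
  edge : Fin m ≃ graph.edgeSet
  pos : Fin m → Fin n
  neg : Fin m → Fin n
  orientation : ∀ e, (edge e : Sym2 (Fin n)) = s(pos e, neg e)
  M : Fin n → ℝ
  E : Fin n → ℝ
  b : Fin m → ℝ
  M_nonneg : ∀ i, 0 ≤ M i
  exists_M_pos : ∃ i, 0 < M i
  E_pos : ∀ i, 0 < E i
  b_pos : ∀ e, 0 < b e

/-- The incidence matrix `D` of the chosen orientation. -/
def PowerNetwork.incidence {n m : ℕ} (G : PowerNetwork n m) : Matrix (Fin m) (Fin n) ℝ :=
  Matrix.of fun e i => if i = G.pos e then 1 else if i = G.neg e then -1 else 0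

/-- Design parameters of the controller: the controlled buses `Iu`, the buses `Iw ⊆ Iu` with a
frequency requirement and their safe bounds, the cost weights `c`, `d`, the bounds `ε` on the
input, and the step size `T`.  The low-pass filter at a controlled bus is
`κ i * α̇ i = -(1 / τ i) * α i - ω i + u i`; both `κ i = 1` and `κ i = M i` are allowed. -/
structure MPCParams (n : ℕ) where
  Iu : Finset (Fin n)
  Iw : Finset (Fin n)
  Iw_subset : Iw ⊆ Iu
  wlo : Fin n → ℝ
  whi : Fin n → ℝ
  wlo_lt_whi : ∀ i ∈ Iw, wlo i < whi i
  c : Fin n → ℝ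
  d : Fin n → ℝ
  ε : Fin n → ℝ
  τ : Fin n → ℝ
  κ : Fin n → ℝ
  T : ℝ
  c_pos : ∀ i ∈ Iu, 0 < c i
  d_pos : ∀ i ∈ Iw, 0 < d i
  ε_pos : ∀ i ∈ Iu, 0 < ε i
  τ_pos : ∀ i ∈ Iu, 0 < τ i
  κ_nonneg : ∀ i ∈ Iu, 0 ≤ κ i
  T_pos : 0 < T

/-- Coordinates of the augmented state `x = (λ, ω, α) ∈ ℝ^(m+2n)`. -/
abbrev StateIdx (n m : ℕ) : Type := Fin m ⊕ (Fin n ⊕ Fin n)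

abbrev State (n m : ℕ) : Type := StateIdx n m → ℝ

def State.freq {n m : ℕ} (x : State n m) (i : Fin n) : ℝ := x (Sum.inr (Sum.inl i))

def State.filt {n m : ℕ} (x : State n m) (i : Fin n) : ℝ := x (Sum.inr (Sum.inr i))

/-! The linearized continuous-time model `Gt * ẋ = At * x + Bt₁ * p + Bt₂ * u`, that is
`λ̇ = D ω`, `M ω̇ = -E ω - Dᵀ Y_b λ + p + α`, `κ i α̇ i = -(1 / τ i) α i - ω i + u i` for `i ∈ Iu`
and `0 = -α i` for `i ∉ Iu`. -/

/-- The diagonal matrix in front of `ẋ`. -/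
def modelG {n m : ℕ} (G : PowerNetwork n m) (P : MPCParams n) :
    Matrix (StateIdx n m) (StateIdx n m) ℝ :=
  Matrix.diagonal
    (Sum.elim (fun _ => 1) (Sum.elim G.M (fun i => if i ∈ P.Iu then P.κ i else 0)))

/-- The system matrix of the linearized model. -/
def modelA {n m : ℕ} (G : PowerNetwork n m) (P : MPCParams n) :
    Matrix (StateIdx n m) (StateIdx n m) ℝ :=
  Matrix.fromBlocks
    0 (Matrix.fromCols G.incidence 0)
    (Matrix.fromRows (-(G.incidenceᵀ * Matrix.diagonal G.b)) 0)
    (Matrix.fromBlocks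
      (-Matrix.diagonal G.E) 1
      (Matrix.diagonal fun i => if i ∈ P.Iu then -1 else 0)
      (Matrix.diagonal fun i => if i ∈ P.Iu then -(1 / P.τ i) else -1))

/-- The control input matrix of the linearized model. -/
def modelB₂ {n : ℕ} (m : ℕ) (P : MPCParams n) : Matrix (StateIdx n m) (Fin n) ℝ :=
  Matrix.fromRows 0
    (Matrix.fromRows 0 (Matrix.diagonal fun i => if i ∈ P.Iu then 1 else 0))

/-- `F` and `B₂` are those of the backward Euler discretization with step size `T`. -/
def IsBackwardEuler {n m : ℕ} (G : PowerNetwork n m) (P : MPCParams n)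
    (F : Matrix (StateIdx n m) (StateIdx n m) ℝ) (B₂ : Matrix (StateIdx n m) (Fin n) ℝ) : Prop :=
  F = modelG G P - P.T • modelA G P ∧ B₂ = P.T • modelB₂ m P

/-- `F` and `B₂` are those of the forward Euler discretization with step size `T`. -/
def IsForwardEuler {n m : ℕ} (G : PowerNetwork n m) (P : MPCParams n)
    (F : Matrix (StateIdx n m) (StateIdx n m) ℝ) (B₂ : Matrix (StateIdx n m) (Fin n) ℝ) : Prop :=
  F = modelG G P ∧ B₂ = P.T • modelB₂ m P

/-- The prediction model `F x(k+1) = A x(k) + B₁ p(k) + B₂ u`, `k = 1, …, N-1`, for a trajectory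
`x(1), …, x(N)`; the position `k` of the horizon has index `k - 1` in `Fin N`. -/
def Dynamics {n m N : ℕ} (F A : Matrix (StateIdx n m) (StateIdx n m) ℝ)
    (B₁ B₂ : Matrix (StateIdx n m) (Fin n) ℝ)
    (p : Fin N → Fin n → ℝ) (X : Fin N → State n m) (u : Fin n → ℝ) : Prop :=
  ∀ (k : ℕ) (hk : k + 1 < N),
    F *ᵥ X ⟨k + 1, hk⟩ =
      A *ᵥ X ⟨k, Nat.lt_of_succ_lt hk⟩ + B₁ *ᵥ p ⟨k, Nat.lt_of_succ_lt hk⟩ + B₂ *ᵥ u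

/-- The set `𝔸` of inputs supported on the controlled buses. -/
def Admissible {n : ℕ} (P : MPCParams n) : Set (Fin n → ℝ) :=
  {u | ∀ i, i ∉ P.Iu → u i = 0}

/-- The only admissible input that, from the zero initial state and with zero power injection,
leaves the filter states of all the controlled buses at zero over the whole horizon is `0`. -/
def InputDistinguishable {n m : ℕ} (P : MPCParams n) (N : ℕ)
    (F A : Matrix (StateIdx n m) (StateIdx n m) ℝ)
    (B₁ B₂ : Matrix (StateIdx n m) (Fin n) ℝ) : Prop :=
  ∀ (X : Fin N → State n m) (u : Fin n → ℝ), u ∈ Admissible P →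
    Dynamics F A B₁ B₂ 0 X u → (∀ h : 0 < N, X ⟨0, h⟩ = 0) →
    (∀ k, ∀ i ∈ P.Iu, (X k).filt i = 0) → u = 0

/-- Coordinates of the parameter `z = (P^fcst, x(t^w)) ∈ ℝ^((N+2)n+m)`. -/
abbrev ParamIdx (n m N : ℕ) : Type := (Fin N × Fin n) ⊕ StateIdx n m

/-- The forecasted power injections `p(1), …, p(N)` in `z`. -/
def forecast {n m N : ℕ} (z : EuclideanSpace ℝ (ParamIdx n m N)) : Fin N → Fin n → ℝ :=
  fun k i => z (Sum.inl (k, i))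

/-- The sampled state `x(t^w)` in `z`. -/
def sampledState {n m N : ℕ} (z : EuclideanSpace ℝ (ParamIdx n m N)) : State n m :=
  fun j => z (Sum.inr j)

/-- The decision variables `(X, u, S)` of the optimization problem. -/
structure Decision (n m N : ℕ) (P : MPCParams n) where
  X : Fin N → State n m
  u : Fin n → ℝ
  S : Fin N → P.Iw → ℝ

/-- The objective function `g(X, u, S)`. -/
def cost {n m N : ℕ} {P : MPCParams n} (y : Decision n m N P) : ℝ :=
  ∑ k : Fin N, (∑ i ∈ P.Iu, P.c i * (y.X k).filt i ^ 2 + ∑ i : P.Iw, P.d i * y.S k i ^ 2)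

/-- The constraints of the optimization problem with data `z`. -/
structure IsFeasible {n m N : ℕ} {P : MPCParams n}
    (F A : Matrix (StateIdx n m) (StateIdx n m) ℝ)
    (B₁ B₂ : Matrix (StateIdx n m) (Fin n) ℝ)
    (z : EuclideanSpace ℝ (ParamIdx n m N)) (y : Decision n m N P) : Prop where
  dynamics : Dynamics F A B₁ B₂ (forecast z) y.X y.u
  admissible : y.u ∈ Admissible P
  initial : ∀ h : 0 < N, y.X ⟨0, h⟩ = sampledState z
  soft_frequency : ∀ (i : P.Iw) (k : Fin N),
    P.wlo i - y.S k i ≤ (y.X k).freq i ∧ (y.X k).freq i ≤ P.whi i + y.S k i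
  input_bound : ∀ i ∈ P.Iu, |y.u i| ≤ P.ε i * |(sampledState z).filt i|

/-- `y = (X, u, S)` is an optimal solution of the problem with data `z`. -/
def IsOptimal {n m N : ℕ} {P : MPCParams n}
    (F A : Matrix (StateIdx n m) (StateIdx n m) ℝ)
    (B₁ B₂ : Matrix (StateIdx n m) (Fin n) ℝ)
    (z : EuclideanSpace ℝ (ParamIdx n m N)) (y : Decision n m N P) : Prop :=
  IsFeasible F A B₁ B₂ z y ∧ ∀ y' : Decision n m N P, IsFeasible F A B₁ B₂ z y' → cost y ≤ cost y'

/-- The polyhedron `{y | H y ≤ h}` (componentwise inequality). -/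
def polyhedron {ι : Type*} [Fintype ι] {r : ℕ} (H : Matrix (Fin r) ι ℝ) (h : Fin r → ℝ) :
    Set (EuclideanSpace ℝ ι) :=
  {y | ∀ j, (H *ᵥ y.ofLp) j ≤ h j}

end

/-!
The trajectory is a linear function of the parameter `z` and the input `u`, and for a given
trajectory the cheapest slack is the distance of the frequency to its safe interval.
Eliminating both leaves a program in `u` alone (`SoftBoxProgram`, `reducedProgram`): minimize a sum
of squares of linear functionals of `(z, u)` and of squared distances to intervals, over a box whose
half-widths are absolute values of linear functionals of `z`.  Optimal decisions correspond exactly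
to minimizers of this program (`isOptimal_iff`).

Input distinguishability says that the squares of linear functionals determine `u`, so the objective
is strictly convex in `u`, and a minimizer over the compact box exists and is unique.  For both Euler
schemes distinguishability already follows from the first step; for backward Euler this uses that
`M + T E + T² Dᵀ Y_b D` is positive definite.

The squared distance to an interval lies above its tangents and below its tangents plus a unit
parabola, so that minimality is equivalent to first-order conditions, coordinate by coordinate
(`SoftBoxProgram.isMinimizer_iff`).  Prescribe on which side of its interval each soft constraint
lies, which bounds are active, and the signs of the half-widths.  The first-order conditions then
become affine equations and inequalities in `(z, u)`.  The equations determine `u` as an affine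
function of `z` (`SoftBoxProgram.criticalSystem_injective`), and substituting it into the remaining
conditions gives a polyhedron in `z`.  These finitely many polyhedra cover the parameter space
(`SoftBoxProgram.exists_critical_regions`).  Being closed, they yield continuity, and the Lipschitz
bound propagates along segments from piece to piece (`LipschitzWith.of_finite_closed_cover`).
-/

/-! ### Polyhedra -/

/-- A set of the form `{y | H y ≤ h}`. -/
def IsPolyhedral {ι : Type*} [Fintype ι] (s : Set (EuclideanSpace ℝ ι)) : Prop :=
  ∃ (r : ℕ) (H : Matrix (Fin r) ι ℝ) (h : Fin r → ℝ), s = polyhedron H h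

section Polyhedral

variable {ι : Type*} [Fintype ι]

/-- The matrix of the linear part of an affine map between coordinate spaces. -/
noncomputable def affineMatrix [DecidableEq ι] {κ : Type*}
    (f : EuclideanSpace ℝ ι →ᵃ[ℝ] (κ → ℝ)) : Matrix κ ι ℝ :=
  LinearMap.toMatrix' (f.linear ∘ₗ (WithLp.linearEquiv 2 ℝ (ι → ℝ)).symm.toLinearMap)

theorem affineMatrix_mulVec_add [DecidableEq ι] {κ : Type*}
    (f : EuclideanSpace ℝ ι →ᵃ[ℝ] (κ → ℝ)) (z : EuclideanSpace ℝ ι) :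
    affineMatrix f *ᵥ z.ofLp + f 0 = f z := by
  rw [affineMatrix, LinearMap.toMatrix'_mulVec]
  have h := congrFun f.decomp z
  simp only [Pi.add_apply] at h
  rw [h]
  rfl

theorem isPolyhedral_setOf_forall_le {κ : Type*} [Finite κ]
    (f g : κ → EuclideanSpace ℝ ι →ᵃ[ℝ] ℝ) :
    IsPolyhedral {z | ∀ q, f q z ≤ g q z} := by
  classical
  obtain ⟨r, ⟨e⟩⟩ := Finite.exists_equiv_fin κ
  let F : EuclideanSpace ℝ ι →ᵃ[ℝ] (Fin r → ℝ) :=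
    AffineMap.pi fun j => f (e.symm j) - g (e.symm j)
  refine ⟨r, affineMatrix F, -F 0, ?_⟩
  ext z
  have h : ∀ j, (affineMatrix F *ᵥ z.ofLp) j + F 0 j = f (e.symm j) z - g (e.symm j) z :=
    fun j => congrFun (affineMatrix_mulVec_add F z) j
  simp only [polyhedron, Set.mem_ofPred_eq, Pi.neg_apply]
  constructor
  · intro hz j
    linarith [h j, hz (e.symm j)]
  · intro hz q
    have := h (e q)
    have h2 := hz (e q)
    rw [e.symm_apply_apply] at this
    linarith

theorem isPolyhedral_setOf_le (f g : EuclideanSpace ℝ ι →ᵃ[ℝ] ℝ) :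
    IsPolyhedral {z | f z ≤ g z} := by
  simpa using isPolyhedral_setOf_forall_le (κ := Unit) (fun _ => f) (fun _ => g)

theorem IsPolyhedral.setOf_forall {κ : Type*} [Finite κ] {p : κ → EuclideanSpace ℝ ι → Prop}
    (hp : ∀ q, IsPolyhedral {z | p q z}) : IsPolyhedral {z | ∀ q, p q z} := by
  classical
  choose r H h e using hp
  let row : (Σ q, Fin (r q)) → EuclideanSpace ℝ ι →ₗ[ℝ] ℝ := fun q =>
    LinearMap.proj q.2 ∘ₗ (H q.1).mulVecLin ∘ₗ (WithLp.linearEquiv 2 ℝ (ι → ℝ)).toLinearMap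
  convert isPolyhedral_setOf_forall_le (fun q => (row q).toAffineMap)
    (fun q => AffineMap.const ℝ _ (h q.1 q.2)) using 1
  ext z
  have e' : ∀ q, p q z ↔ ∀ j, (H q *ᵥ z.ofLp) j ≤ h q j := fun q => by
    have := Set.ext_iff.1 (e q) z
    simpa [polyhedron] using this
  simp only [Set.mem_ofPred_eq, e', Sigma.forall]
  rfl

theorem IsPolyhedral.setOf_and {p q : EuclideanSpace ℝ ι → Prop}
    (hp : IsPolyhedral {z | p z}) (hq : IsPolyhedral {z | q z}) :
    IsPolyhedral {z | p z ∧ q z} := by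
  have := IsPolyhedral.setOf_forall (p := fun b : Bool => if b then p else q)
    (by rintro (_ | _) <;> simpa)
  convert this using 2
  ext z
  simp [and_comm]

theorem IsPolyhedral.isClosed {s : Set (EuclideanSpace ℝ ι)} (hs : IsPolyhedral s) :
    IsClosed s := by
  obtain ⟨r, H, h, rfl⟩ := hs
  simp only [polyhedron, Set.ofPred_forall]
  refine isClosed_iInter fun j => isClosed_le ?_ continuous_const
  have : Continuous fun y : EuclideanSpace ℝ ι => H *ᵥ y.ofLp :=
    continuous_const.matrix_mulVec (PiLp.continuous_ofLp 2 _)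
  exact (continuous_apply j).comp this

end Polyhedral

/-! ### Piecewise Lipschitz functions -/

/-- A continuous function that is `C`-Lipschitz on each of finitely many closed sets covering a
real normed space is `C`-Lipschitz: along a segment, every point is a limit from the right of points
of the segment that lie in one and the same piece with it, so that the estimate propagates. -/
theorem LipschitzWith.of_finite_closed_cover {E E' Ξ : Type*} [NormedAddCommGroup E]
    [NormedSpace ℝ E] [PseudoMetricSpace E'] [Finite Ξ] {C : ℝ≥0} {f : E → E'}
    (hf : Continuous f) {R : Ξ → Set E} (hR : ∀ ξ, IsClosed (R ξ)) (hcov : ∀ z, ∃ ξ, z ∈ R ξ)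
    (hlip : ∀ ξ, LipschitzOnWith C f (R ξ)) : LipschitzWith C f := by
  refine LipschitzWith.of_dist_le_mul fun x y => ?_
  let γ : ℝ → E := fun t => AffineMap.lineMap x y t
  have hγ : Continuous γ := AffineMap.lineMap_continuous
  have hdist : ∀ s t, dist (γ s) (γ t) = dist s t * dist x y := fun s t =>
    dist_lineMap_lineMap x y s t
  let S : Set ℝ := {t | dist (f x) (f (γ t)) ≤ C * (t * dist x y)}
  have hS : IsClosed (S ∩ Set.Icc 0 1) := by
    refine IsClosed.inter (isClosed_le ?_ ?_) isClosed_Icc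
    · exact continuous_const.dist (hf.comp hγ)
    · fun_prop
  have h0 : (0 : ℝ) ∈ S := by simp [S, γ]
  have key : Set.Icc (0 : ℝ) 1 ⊆ S := by
    refine hS.Icc_subset_of_forall_exists_gt h0 ?_
    rintro t ⟨ht, ht0, ht1⟩ y' (hy' : t < y')
    have hfreq : ∃ᶠ s in nhdsWithin t (Set.Ioi t), ∃ ξ, γ s ∈ R ξ :=
      (Filter.Eventually.of_forall fun s => hcov (γ s)).frequently
    rw [Filter.frequently_exists] at hfreq
    obtain ⟨ξ, hξ⟩ := hfreq
    have htξ : γ t ∈ R ξ := by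
      have : t ∈ closure (γ ⁻¹' R ξ) :=
        mem_closure_iff_frequently.2 (hξ.filter_mono nhdsWithin_le_nhds)
      rwa [((hR ξ).preimage hγ).closure_eq] at this
    obtain ⟨s, hsξ, hts, hsy⟩ := (hξ.and_eventually (Ioc_mem_nhdsGT hy')).exists
    refine ⟨s, ?_, hts, hsy⟩
    have h1 : dist (f x) (f (γ t)) ≤ C * (t * dist x y) := ht
    have h2 := (hlip ξ).dist_le_mul (γ t) htξ (γ s) hsξ
    rw [hdist, dist_comm t s, Real.dist_eq, abs_of_pos (sub_pos.2 hts)] at h2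
    have h3 := dist_triangle (f x) (f (γ t)) (f (γ s))
    change dist (f x) (f (γ s)) ≤ C * (s * dist x y)
    linarith
  have h1 : (1 : ℝ) ∈ S := key (by simp)
  simpa [S, γ] using h1

/-- A map that agrees with affine maps on finitely many polyhedral sets covering the parameter space
is continuous, piecewise affine, and Lipschitz with the largest of the norms of the slopes. -/
theorem piecewise_affine_of_polyhedral_cover {ι ν Ξ : Type*} [Fintype ι] [DecidableEq ι]
    [Fintype ν] [DecidableEq ν] [Finite Ξ] (u : EuclideanSpace ℝ ι → EuclideanSpace ℝ ν)
    {R : Ξ → Set (EuclideanSpace ℝ ι)} (hR : ∀ ξ, IsPolyhedral (R ξ))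
    (hcov : ∀ z, ∃ ξ, z ∈ R ξ) (f : Ξ → EuclideanSpace ℝ ι →ᵃ[ℝ] (ν → ℝ))
    (hf : ∀ ξ, ∀ z ∈ R ξ, u z = WithLp.toLp 2 (f ξ z)) :
    Continuous u ∧
      ∃ (l : ℕ) (r : Fin l → ℕ)
        (H : ∀ ξ : Fin l, Matrix (Fin (r ξ)) ι ℝ)
        (h : ∀ ξ : Fin l, Fin (r ξ) → ℝ)
        (K : Fin l → Matrix ν ι ℝ)
        (k : Fin l → ν → ℝ),
        (∀ z, ∃ ξ, z ∈ polyhedron (H ξ) (h ξ)) ∧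
        (∀ ξ, ∀ z ∈ polyhedron (H ξ) (h ξ), u z = WithLp.toLp 2 (K ξ *ᵥ z.ofLp + k ξ)) ∧
        LipschitzWith (Finset.univ.sup fun ξ => ‖K ξ‖₊) u := by
  obtain ⟨l, ⟨e⟩⟩ := Finite.exists_equiv_fin Ξ
  have hclosed : ∀ ξ, IsClosed (R ξ) := fun ξ => (hR ξ).isClosed
  have haff : ∀ ξ, ∀ z ∈ R ξ,
      u z = WithLp.toLp 2 (affineMatrix (f ξ) *ᵥ z.ofLp + f ξ 0) := fun ξ z hz => by
    rw [affineMatrix_mulVec_add, hf ξ z hz]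
  have hlip : ∀ ξ, LipschitzOnWith ‖affineMatrix (f ξ)‖₊ u (R ξ) := by
    refine fun ξ => LipschitzOnWith.of_dist_le_mul fun x hx y hy => ?_
    rw [haff ξ x hx, haff ξ y hy, dist_eq_norm, dist_eq_norm, ← WithLp.toLp_sub,
      add_sub_add_right_eq_sub, ← Matrix.mulVec_sub, ← WithLp.ofLp_sub]
    exact Matrix.l2_opNorm_mulVec _ _
  have hcont : Continuous u := by
    refine (locallyFinite_of_finite R).continuous (Set.eq_univ_of_forall fun z => ?_) hclosed
      fun ξ => (hlip ξ).continuousOn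
    exact Set.mem_iUnion.2 (hcov z)
  choose r H h hRH using hR
  refine ⟨hcont, l, fun ξ => r (e.symm ξ), fun ξ => H (e.symm ξ), fun ξ => h (e.symm ξ),
    fun ξ => affineMatrix (f (e.symm ξ)), fun ξ => f (e.symm ξ) 0, fun z => ?_, fun ξ z hz => ?_, ?_⟩
  · obtain ⟨ξ, hξ⟩ := hcov z
    refine ⟨e ξ, ?_⟩
    rw [← hRH, e.symm_apply_apply]
    exact hξ
  · rw [← hRH] at hz
    exact haff _ z hz
  · refine LipschitzWith.of_finite_closed_cover hcont hclosed hcov fun ξ => (hlip ξ).weaken ?_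
    have := Finset.le_sup (f := fun ξ => ‖affineMatrix (f (e.symm ξ))‖₊) (Finset.mem_univ (e ξ))
    simpa using this

/-! ### The signed distance to an interval -/

/-- The signed excess of `t` over the interval `[lo, hi]`: `t - lo` below, `0` inside, `t - hi`
above. -/
noncomputable def excess (lo hi t : ℝ) : ℝ := t - max lo (min hi t)

/-- The affine branches of `excess`: `neg` below the interval, `zero` inside, `pos` above. -/
noncomputable def excessBranch (lo hi : ℝ) : SignType → ℝ →ᵃ[ℝ] ℝ
  | .neg => AffineMap.id ℝ ℝ - AffineMap.const ℝ ℝ lo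
  | .zero => 0
  | .pos => AffineMap.id ℝ ℝ - AffineMap.const ℝ ℝ hi

/-- The closed interval on which `excess` is given by a branch. -/
def InBranch (lo hi t : ℝ) : SignType → Prop
  | .neg => t ≤ lo
  | .zero => lo ≤ t ∧ t ≤ hi
  | .pos => hi ≤ t

section Excess

variable {lo hi : ℝ} (h : lo ≤ hi) (t t' : ℝ)
include h

theorem excess_cases :
    (t ≤ lo ∧ excess lo hi t = t - lo) ∨ (lo ≤ t ∧ t ≤ hi ∧ excess lo hi t = 0) ∨
      (hi ≤ t ∧ excess lo hi t = t - hi) := by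
  unfold excess
  grind

theorem exists_inBranch : ∃ s, InBranch lo hi t s := by
  rcases excess_cases h t with ⟨h, -⟩ | ⟨h, h', -⟩ | ⟨h, -⟩
  · exact ⟨.neg, h⟩
  · exact ⟨.zero, h, h'⟩
  · exact ⟨.pos, h⟩

variable {t} in
theorem InBranch.excessBranch_eq {s : SignType} (hs : InBranch lo hi t s) :
    excessBranch lo hi s t = excess lo hi t := by
  rcases s with _ | _ | _ <;> simp [InBranch, excessBranch, excess] at hs ⊢ <;> grind

/-- The square of the excess is convex, with derivative twice the excess. -/
theorem excess_sq_lower :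
    excess lo hi t ^ 2 + 2 * excess lo hi t * (t' - t) ≤ excess lo hi t' ^ 2 := by
  rcases excess_cases h t with ⟨h1, e⟩ | ⟨h1, h2, e⟩ | ⟨h1, e⟩ <;>
  rcases excess_cases h t' with ⟨h3, e'⟩ | ⟨h3, h4, e'⟩ | ⟨h3, e'⟩ <;>
  rw [e, e'] <;> nlinarith [sq_nonneg (t' - t)]

/-- The derivative of the square of the excess is 2-Lipschitz. -/
theorem excess_sq_upper :
    excess lo hi t' ^ 2 ≤
      excess lo hi t ^ 2 + 2 * excess lo hi t * (t' - t) + (t' - t) ^ 2 := by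
  rcases excess_cases h t with ⟨h1, e⟩ | ⟨h1, h2, e⟩ | ⟨h1, e⟩ <;>
  rcases excess_cases h t' with ⟨h3, e'⟩ | ⟨h3, h4, e'⟩ | ⟨h3, e'⟩ <;>
  rw [e, e'] <;> nlinarith

end Excess

theorem continuous_excess (lo hi : ℝ) : Continuous (excess lo hi) := by
  unfold excess
  fun_prop

/-! ### Strictly convex box-constrained programs with soft constraints -/

/-- A parametric program in `u : ν → ℝ` with parameter `z : Z`: minimize
`∑ c track(z, u)² + ∑ d excess(soft(z, u))²` subject to `|u i| ≤ |radius i z|`.  The functionals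
`track`, `soft` and `radius` are linear, and the tracking terms determine `u`. -/
structure SoftBoxProgram (Z : Type*) [AddCommGroup Z] [Module ℝ Z] (ν J₁ J₂ : Type*) where
  track : J₁ → Z × (ν → ℝ) →ₗ[ℝ] ℝ
  c : J₁ → ℝ
  soft : J₂ → Z × (ν → ℝ) →ₗ[ℝ] ℝ
  d : J₂ → ℝ
  lo : J₂ → ℝ
  hi : J₂ → ℝ
  radius : ν → Z →ₗ[ℝ] ℝ
  c_pos : ∀ j, 0 < c j
  d_pos : ∀ j, 0 < d j
  lo_le_hi : ∀ j, lo j ≤ hi j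
  eq_zero_of_track : ∀ u, (∀ j, track j (0, u) = 0) → u = 0

namespace SoftBoxProgram

variable {Z : Type*} [AddCommGroup Z] [Module ℝ Z] {ν J₁ J₂ : Type*} [Fintype J₁] [Fintype J₂]
  (Q : SoftBoxProgram Z ν J₁ J₂)

/-- The objective function. -/
noncomputable def objective (z : Z) (u : ν → ℝ) : ℝ :=
  ∑ j, Q.c j * Q.track j (z, u) ^ 2 +
    ∑ j, Q.d j * excess (Q.lo j) (Q.hi j) (Q.soft j (z, u)) ^ 2

/-- The feasible set. -/
def box (z : Z) : Set (ν → ℝ) := {u | ∀ i, |u i| ≤ |Q.radius i z|}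

/-- `u` minimizes the objective over the feasible set. -/
def IsMinimizer (z : Z) (u : ν → ℝ) : Prop :=
  u ∈ Q.box z ∧ ∀ v ∈ Q.box z, Q.objective z u ≤ Q.objective z v

/-- The derivative of the objective with respect to `u`. -/
noncomputable def slope (z : Z) (u : ν → ℝ) : (ν → ℝ) →ₗ[ℝ] ℝ :=
  (∑ j, (2 * (Q.c j * Q.track j (z, u))) • Q.track j +
    ∑ j, (2 * (Q.d j * excess (Q.lo j) (Q.hi j) (Q.soft j (z, u)))) • Q.soft j) ∘ₗ
      LinearMap.inr ℝ Z (ν → ℝ)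

theorem slope_apply (z : Z) (u v : ν → ℝ) :
    Q.slope z u v = ∑ j, 2 * (Q.c j * Q.track j (z, u)) * Q.track j (0, v) +
      ∑ j, 2 * (Q.d j * excess (Q.lo j) (Q.hi j) (Q.soft j (z, u))) * Q.soft j (0, v) := by
  simp [slope]

/-- A quadratic bound for the variation of the objective from below. -/
theorem le_objective_add (z : Z) (u v : ν → ℝ) :
    Q.objective z u + Q.slope z u v + ∑ j, Q.c j * Q.track j (0, v) ^ 2 ≤
      Q.objective z (u + v) := by
  have e : ((z, u + v) : Z × (ν → ℝ)) = (z, u) + (0, v) := by simp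
  rw [slope_apply, objective, objective, e]
  simp only [map_add]
  have h1 : ∑ j, Q.c j * (Q.track j (z, u) + Q.track j (0, v)) ^ 2 =
      ∑ j, Q.c j * Q.track j (z, u) ^ 2 +
        ∑ j, 2 * (Q.c j * Q.track j (z, u)) * Q.track j (0, v) +
        ∑ j, Q.c j * Q.track j (0, v) ^ 2 := by
    rw [← Finset.sum_add_distrib, ← Finset.sum_add_distrib]
    exact Finset.sum_congr rfl fun j _ => by ring
  have h2 : ∑ j, Q.d j * excess (Q.lo j) (Q.hi j) (Q.soft j (z, u)) ^ 2 +
        ∑ j, 2 * (Q.d j * excess (Q.lo j) (Q.hi j) (Q.soft j (z, u))) * Q.soft j (0, v) ≤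
      ∑ j, Q.d j * excess (Q.lo j) (Q.hi j) (Q.soft j (z, u) + Q.soft j (0, v)) ^ 2 := by
    rw [← Finset.sum_add_distrib]
    refine Finset.sum_le_sum fun j _ => ?_
    have := mul_le_mul_of_nonneg_left (excess_sq_lower (Q.lo_le_hi j) (Q.soft j (z, u))
      (Q.soft j (z, u) + Q.soft j (0, v))) (Q.d_pos j).le
    linarith
  linarith

/-- A quadratic bound for the variation of the objective from above. -/
theorem objective_add_le (z : Z) (u v : ν → ℝ) :
    Q.objective z (u + v) ≤ Q.objective z u + Q.slope z u v +
      (∑ j, Q.c j * Q.track j (0, v) ^ 2 + ∑ j, Q.d j * Q.soft j (0, v) ^ 2) := by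
  have e : ((z, u + v) : Z × (ν → ℝ)) = (z, u) + (0, v) := by simp
  rw [slope_apply, objective, objective, e]
  simp only [map_add]
  have h1 : ∑ j, Q.c j * (Q.track j (z, u) + Q.track j (0, v)) ^ 2 =
      ∑ j, Q.c j * Q.track j (z, u) ^ 2 +
        ∑ j, 2 * (Q.c j * Q.track j (z, u)) * Q.track j (0, v) +
        ∑ j, Q.c j * Q.track j (0, v) ^ 2 := by
    rw [← Finset.sum_add_distrib, ← Finset.sum_add_distrib]
    exact Finset.sum_congr rfl fun j _ => by ring
  have h2 : ∑ j, Q.d j * excess (Q.lo j) (Q.hi j) (Q.soft j (z, u) + Q.soft j (0, v)) ^ 2 ≤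
      ∑ j, Q.d j * excess (Q.lo j) (Q.hi j) (Q.soft j (z, u)) ^ 2 +
        ∑ j, 2 * (Q.d j * excess (Q.lo j) (Q.hi j) (Q.soft j (z, u))) * Q.soft j (0, v) +
        ∑ j, Q.d j * Q.soft j (0, v) ^ 2 := by
    rw [← Finset.sum_add_distrib, ← Finset.sum_add_distrib]
    refine Finset.sum_le_sum fun j _ => ?_
    have := mul_le_mul_of_nonneg_left (excess_sq_upper (Q.lo_le_hi j) (Q.soft j (z, u))
      (Q.soft j (z, u) + Q.soft j (0, v))) (Q.d_pos j).le
    linarith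
  linarith

theorem isMinimizer_of_slope_nonneg {z : Z} {u : ν → ℝ} (hu : u ∈ Q.box z)
    (h : ∀ v, u + v ∈ Q.box z → 0 ≤ Q.slope z u v) : Q.IsMinimizer z u := by
  refine ⟨hu, fun v hv => ?_⟩
  have h1 := Q.le_objective_add z u (v - u)
  have h2 := h (v - u) (by simpa using hv)
  have h3 : 0 ≤ ∑ j, Q.c j * Q.track j (0, v - u) ^ 2 :=
    Finset.sum_nonneg fun j _ => mul_nonneg (Q.c_pos j).le (sq_nonneg _)
  rw [add_sub_cancel] at h1
  linarith

omit [Fintype J₁] [Fintype J₂] in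
theorem add_smul_mem_box {z : Z} {u v : ν → ℝ} (hu : u ∈ Q.box z) (hv : u + v ∈ Q.box z) {t : ℝ}
    (ht0 : 0 ≤ t) (ht1 : t ≤ 1) : u + t • v ∈ Q.box z := by
  intro i
  have h1 := abs_le.1 (hu i)
  have h2 := abs_le.1 (hv i)
  simp only [Pi.add_apply, Pi.smul_apply, smul_eq_mul] at h2 ⊢
  exact abs_le.2 ⟨by nlinarith, by nlinarith⟩

variable {Q} in
theorem IsMinimizer.slope_nonneg {z : Z} {u v : ν → ℝ} (hu : Q.IsMinimizer z u)
    (hv : u + v ∈ Q.box z) : 0 ≤ Q.slope z u v := by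
  set q := ∑ j, Q.c j * Q.track j (0, v) ^ 2 + ∑ j, Q.d j * Q.soft j (0, v) ^ 2 with hq
  -- Moving by `t v` changes the objective by at most `t * slope + t² q`.
  have key : ∀ t : ℝ, 0 < t → t ≤ 1 → 0 ≤ Q.slope z u v + t * q := by
    intro t ht0 ht1
    have h1 := hu.2 _ (Q.add_smul_mem_box hu.1 hv ht0.le ht1)
    have h2 := Q.objective_add_le z u (t • v)
    have e : ((0, t • v) : Z × (ν → ℝ)) = t • (0, v) := by simp
    have h3 : ∑ j, Q.c j * Q.track j (0, t • v) ^ 2 + ∑ j, Q.d j * Q.soft j (0, t • v) ^ 2 =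
        t ^ 2 * q := by
      rw [e, hq, mul_add, Finset.mul_sum, Finset.mul_sum]
      congr 1 <;> exact Finset.sum_congr rfl fun j _ => by rw [map_smul, smul_eq_mul]; ring
    rw [h3, map_smul, smul_eq_mul] at h2
    have h4 : 0 ≤ t * (Q.slope z u v + t * q) := by linarith
    exact nonneg_of_mul_nonneg_right h4 ht0
  have hlim : Filter.Tendsto (fun t : ℝ => Q.slope z u v + t * q) (nhdsWithin 0 (Set.Ioi 0))
      (nhds (Q.slope z u v + 0 * q)) :=
    ((by fun_prop : Continuous fun t : ℝ => Q.slope z u v + t * q).tendsto 0).mono_left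
      nhdsWithin_le_nhds
  rw [zero_mul, add_zero] at hlim
  refine ge_of_tendsto hlim ?_
  filter_upwards [Ioc_mem_nhdsGT one_pos] with t ht using key t ht.1 ht.2

variable {Q} in
/-- The minimizer is unique because the tracking terms make the objective strictly convex. -/
theorem IsMinimizer.unique {z : Z} {u v : ν → ℝ} (hu : Q.IsMinimizer z u)
    (hv : Q.IsMinimizer z v) : v = u := by
  have h1 := Q.le_objective_add z u (v - u)
  have h2 := hu.slope_nonneg (v := v - u) (by simpa using hv.1)
  have h3 := hv.2 u hu.1
  rw [add_sub_cancel] at h1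
  have h4 : ∀ j ∈ Finset.univ, 0 ≤ Q.c j * Q.track j (0, v - u) ^ 2 :=
    fun j _ => mul_nonneg (Q.c_pos j).le (sq_nonneg _)
  have h5 : ∑ j, Q.c j * Q.track j (0, v - u) ^ 2 = 0 :=
    le_antisymm (by linarith) (Finset.sum_nonneg h4)
  rw [Finset.sum_eq_zero_iff_of_nonneg h4] at h5
  refine sub_eq_zero.1 (Q.eq_zero_of_track _ fun j => ?_)
  simpa [(Q.c_pos j).ne'] using h5 j (Finset.mem_univ j)

variable [Fintype ν]

theorem exists_isMinimizer (z : Z) : ∃ u, Q.IsMinimizer z u := by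
  have hK : IsCompact (Q.box z) := by
    have : Q.box z = Set.pi Set.univ fun i => Set.Icc (-|Q.radius i z|) |Q.radius i z| := by
      ext u
      simp [box, abs_le, Pi.le_def, forall_and]
    rw [this]
    exact isCompact_univ_pi fun i => isCompact_Icc
  have hcont : ∀ f : Z × (ν → ℝ) →ₗ[ℝ] ℝ, Continuous fun u => f (z, u) := by
    intro f
    have : (fun u => f (z, u)) = fun u => f (z, 0) + (f ∘ₗ LinearMap.inr ℝ Z (ν → ℝ)) u := by
      ext u
      simp [← map_add]
    rw [this]
    exact continuous_const.add (LinearMap.continuous_of_finiteDimensional _)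
  obtain ⟨u, hu, hmin⟩ := hK.exists_isMinOn (f := Q.objective z) ⟨0, fun i => by simp⟩ (by
    unfold objective
    refine Continuous.continuousOn (Continuous.add ?_ ?_) <;>
      refine continuous_finsetSum _ fun j _ => ?_
    · exact continuous_const.mul ((hcont _).pow 2)
    · exact continuous_const.mul (((continuous_excess _ _).comp (hcont _)).pow 2))
  exact ⟨u, hu, fun v hv => hmin hv⟩

/-! ### First-order conditions -/

variable [DecidableEq ν]

theorem slope_eq_sum (z : Z) (u v : ν → ℝ) :
    Q.slope z u v = ∑ i, v i * Q.slope z u (Pi.single i 1) := by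
  rw [LinearMap.pi_apply_eq_sum_univ]
  refine Finset.sum_congr rfl fun i _ => ?_
  rw [smul_eq_mul]
  congr 2
  ext j
  simp [Pi.single_apply, eq_comm]

/-- The first-order conditions in a single coordinate: `t` is the coordinate, `r` the radius of its
interval and `g` the partial derivative of the objective.  `neg` and `pos` say that the lower or the
upper bound is active, `zero` that the partial derivative vanishes. -/
def CoordinateOptimal (t r g : ℝ) : SignType → Prop
  | .neg => t = -r ∧ 0 ≤ g
  | .zero => g = 0 ∧ -r ≤ t ∧ t ≤ r
  | .pos => t = r ∧ g ≤ 0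

theorem isMinimizer_iff (z : Z) (u : ν → ℝ) :
    Q.IsMinimizer z u ↔
      ∀ i, ∃ s, CoordinateOptimal (u i) |Q.radius i z| (Q.slope z u (Pi.single i 1)) s := by
  constructor
  · intro h i
    have hb := abs_le.1 (h.1 i)
    have hmove : ∀ t, |t| ≤ |Q.radius i z| → 0 ≤ (t - u i) * Q.slope z u (Pi.single i 1) := by
      intro t ht
      have := h.slope_nonneg (v := Pi.single i (t - u i)) (fun k => by
        by_cases hk : k = i
        · subst hk
          simpa using ht
        · simpa [hk] using h.1 k)
      rw [slope_eq_sum, Finset.sum_eq_single i (by simp +contextual) (by simp)] at this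
      simpa using this
    have hlow := hmove (-|Q.radius i z|) (by simp)
    have hup := hmove |Q.radius i z| (by simp)
    rcases lt_trichotomy (Q.slope z u (Pi.single i 1)) 0 with hg | hg | hg
    · exact ⟨.pos, le_antisymm hb.2 (by nlinarith), hg.le⟩
    · exact ⟨.zero, hg, hb⟩
    · exact ⟨.neg, le_antisymm (by nlinarith) hb.1, hg.le⟩
  · intro h
    refine Q.isMinimizer_of_slope_nonneg (fun i => ?_) fun v hv => ?_
    · have h0 := abs_nonneg (Q.radius i z)
      obtain ⟨_ | _ | _, hs⟩ := h i <;> simp only [CoordinateOptimal] at hs <;>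
        exact abs_le.2 ⟨by linarith, by linarith⟩
    · rw [slope_eq_sum]
      refine Finset.sum_nonneg fun i _ => ?_
      have hvi := abs_le.1 (hv i)
      simp only [Pi.add_apply] at hvi
      obtain ⟨_ | _ | _, hs⟩ := h i <;> simp only [CoordinateOptimal] at hs
      · simp [hs.1]
      · exact mul_nonneg (by linarith) hs.2
      · exact mul_nonneg_of_nonpos_of_nonpos (by linarith) hs.2

end SoftBoxProgram

/-! ### Affine equations and critical regions -/

/-- An affine equation `f (z, u) = 0` whose linear part is injective in `u` determines `u` as an
affine function of `z`. -/
theorem AffineMap.exists_eq_of_injective {Z U V : Type*} [AddCommGroup Z] [Module ℝ Z]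
    [AddCommGroup U] [Module ℝ U] [AddCommGroup V] [Module ℝ V] (f : Z × U →ᵃ[ℝ] V)
    (hf : ∀ u, f.linear (0, u) = 0 → u = 0) :
    ∃ g : Z →ᵃ[ℝ] U, ∀ z u, f (z, u) = 0 → u = g z := by
  obtain ⟨L, hL⟩ := LinearMap.exists_leftInverse_of_injective
    (f.linear ∘ₗ LinearMap.inr ℝ Z U) (LinearMap.ker_eq_bot'.2 fun u hu => hf u hu)
  refine ⟨-(L.toAffineMap.comp (f.comp (LinearMap.inl ℝ Z U).toAffineMap)), fun z u hu => ?_⟩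
  have h1 : f (z, u) = f.linear (0, u) + f (z, 0) := by
    have := f.map_vadd (z, 0) (0, u)
    simpa using this
  have h2 : L (f.linear (0, u)) = u := LinearMap.congr_fun hL u
  have h3 : f (z, 0) = -f.linear (0, u) := by
    rw [hu] at h1
    exact eq_neg_of_add_eq_zero_right h1.symm
  simp [h3, h2]

/-- The square of the sign is the slope of the branch: `0` inside and `1` outside. -/
theorem excessBranch_linear (lo hi : ℝ) (s : SignType) (t : ℝ) :
    (excessBranch lo hi s).linear t = (s : ℝ) ^ 2 * t := by
  rcases s with _ | _ | _ <;> simp [excessBranch]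

theorem AffineMap.finsetSum_apply {V W κ : Type*} [AddCommGroup V] [Module ℝ V] [AddCommGroup W]
    [Module ℝ W] (s : Finset κ) (f : κ → V →ᵃ[ℝ] W) (x : V) : (∑ j ∈ s, f j) x = ∑ j ∈ s, f j x := by
  classical
  induction s using Finset.induction_on with
  | empty => simp
  | insert a s ha ih => simp [Finset.sum_insert ha, ih]

theorem AffineMap.finsetSum_linear {V W κ : Type*} [AddCommGroup V] [Module ℝ V] [AddCommGroup W]
    [Module ℝ W] (s : Finset κ) (f : κ → V →ᵃ[ℝ] W) :
    (∑ j ∈ s, f j).linear = ∑ j ∈ s, (f j).linear := by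
  classical
  induction s using Finset.induction_on with
  | empty => simp
  | insert a s ha ih => simp [Finset.sum_insert ha, ih]

namespace SoftBoxProgram

variable {Z : Type*} [AddCommGroup Z] [Module ℝ Z] {ν J₁ J₂ : Type*} [Fintype J₁] [Fintype J₂]
  [Fintype ν] [DecidableEq ν] (Q : SoftBoxProgram Z ν J₁ J₂)

/-- The partial derivative of the objective in coordinate `i`, as an affine map, where the soft
constraints are in the branches `σ`. -/
noncomputable def branchSlope (σ : J₂ → SignType) (i : ν) : Z × (ν → ℝ) →ᵃ[ℝ] ℝ :=
  ∑ j, (2 * (Q.c j * Q.track j (0, Pi.single i 1))) • (Q.track j).toAffineMap +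
    ∑ j, (2 * (Q.d j * Q.soft j (0, Pi.single i 1))) •
      (excessBranch (Q.lo j) (Q.hi j) (σ j)).comp (Q.soft j).toAffineMap

/-- The linear functional that equals `|radius i z|` when it is nonnegative; `η i` is the sign of
`radius i z`. -/
def signedRadius (η : ν → Bool) (i : ν) : Z →ₗ[ℝ] ℝ :=
  if η i then Q.radius i else -Q.radius i

/-- The first-order conditions at `(z, u)` with prescribed branches `σ` of the soft constraints,
active bounds `τ` and signs `η` of the radii.  For given `σ`, `τ`, `η` all of them are affine
equations and inequalities in `(z, u)`. -/
def IsCritical (σ : J₂ → SignType) (τ : ν → SignType) (η : ν → Bool) (z : Z) (u : ν → ℝ) : Prop :=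
  (∀ j, InBranch (Q.lo j) (Q.hi j) (Q.soft j (z, u)) (σ j)) ∧
    ∀ i, 0 ≤ Q.signedRadius η i z ∧
      CoordinateOptimal (u i) (Q.signedRadius η i z) (Q.branchSlope σ i (z, u)) (τ i)

omit [Fintype ν] in
variable {Q} in
theorem branchSlope_eq_slope {σ : J₂ → SignType} {z : Z} {u : ν → ℝ}
    (h : ∀ j, InBranch (Q.lo j) (Q.hi j) (Q.soft j (z, u)) (σ j)) (i : ν) :
    Q.branchSlope σ i (z, u) = Q.slope z u (Pi.single i 1) := by
  rw [slope_apply, branchSlope]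
  simp only [AffineMap.coe_add, Pi.add_apply, AffineMap.finsetSum_apply, AffineMap.coe_smul,
    Pi.smul_apply, AffineMap.comp_apply, LinearMap.coe_toAffineMap, smul_eq_mul,
    fun j => (h j).excessBranch_eq (Q.lo_le_hi j)]
  congr 1 <;> exact Finset.sum_congr rfl fun j _ => by ring

omit [Fintype J₁] [Fintype J₂] [Fintype ν] [DecidableEq ν] in
theorem signedRadius_eq_abs {η : ν → Bool} {i : ν} {z : Z} (h : 0 ≤ Q.signedRadius η i z) :
    Q.signedRadius η i z = |Q.radius i z| := by
  unfold signedRadius at h ⊢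
  split_ifs at h ⊢
  · exact (abs_of_nonneg h).symm
  · exact (abs_of_nonpos (by simpa using h)).symm

theorem isMinimizer_iff_exists_isCritical (z : Z) (u : ν → ℝ) :
    Q.IsMinimizer z u ↔ ∃ σ τ η, Q.IsCritical σ τ η z u := by
  rw [isMinimizer_iff]
  constructor
  · intro h
    choose τ hτ using h
    choose σ hσ using fun j => exists_inBranch (Q.lo_le_hi j) (Q.soft j (z, u))
    have hη : ∀ i, 0 ≤ Q.signedRadius (fun i => decide (0 ≤ Q.radius i z)) i z := by
      intro i
      by_cases hi : 0 ≤ Q.radius i z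
      · simp [signedRadius, hi]
      · simpa [signedRadius, hi] using (not_le.1 hi).le
    refine ⟨σ, τ, _, hσ, fun i => ⟨hη i, ?_⟩⟩
    rw [Q.signedRadius_eq_abs (hη i), branchSlope_eq_slope hσ]
    exact hτ i
  · rintro ⟨σ, τ, η, hσ, h⟩ i
    refine ⟨τ i, ?_⟩
    rw [← Q.signedRadius_eq_abs (h i).1, ← branchSlope_eq_slope hσ]
    exact (h i).2

/-- The equation in coordinate `i` among the critical conditions: according to the last argument the
lower bound is active, the partial derivative vanishes, or the upper bound is active. -/
noncomputable def criticalEquation (σ : J₂ → SignType) (η : ν → Bool) (i : ν) :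
    SignType → Z × (ν → ℝ) →ᵃ[ℝ] ℝ
  | .neg => (LinearMap.proj i ∘ₗ LinearMap.snd ℝ Z (ν → ℝ) +
      Q.signedRadius η i ∘ₗ LinearMap.fst ℝ Z (ν → ℝ)).toAffineMap
  | .zero => Q.branchSlope σ i
  | .pos => (LinearMap.proj i ∘ₗ LinearMap.snd ℝ Z (ν → ℝ) -
      Q.signedRadius η i ∘ₗ LinearMap.fst ℝ Z (ν → ℝ)).toAffineMap

/-- The equations among the critical conditions. -/
noncomputable def criticalSystem (σ : J₂ → SignType) (τ : ν → SignType) (η : ν → Bool) :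
    Z × (ν → ℝ) →ᵃ[ℝ] (ν → ℝ) :=
  AffineMap.pi fun i => Q.criticalEquation σ η i (τ i)

omit [Fintype ν] in
variable {Q} in
theorem IsCritical.criticalSystem_eq_zero {σ : J₂ → SignType} {τ : ν → SignType} {η : ν → Bool}
    {z : Z} {u : ν → ℝ} (h : Q.IsCritical σ τ η z u) : Q.criticalSystem σ τ η (z, u) = 0 := by
  ext i
  have hi := (h.2 i).2
  change Q.criticalEquation σ η i (τ i) (z, u) = 0
  generalize τ i = s at hi ⊢
  rcases s with _ | _ | _ <;> simp only [CoordinateOptimal] at hi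
  · exact hi.1
  · simp [criticalEquation, hi.1]
  · simp [criticalEquation, hi.1]

omit [Fintype J₁] [Fintype J₂] in
theorem sum_mul_map_single (f : Z × (ν → ℝ) →ₗ[ℝ] ℝ) (u : ν → ℝ) :
    ∑ i, u i * f (0, Pi.single i 1) = f (0, u) := by
  have := LinearMap.pi_apply_eq_sum_univ (f ∘ₗ LinearMap.inr ℝ Z (ν → ℝ)) u
  simp only [LinearMap.comp_apply, LinearMap.inr_apply, smul_eq_mul] at this
  rw [this]
  refine Finset.sum_congr rfl fun i _ => ?_
  congr 3
  ext j
  simp [Pi.single_apply, eq_comm]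

omit [Fintype ν] in
theorem branchSlope_linear (σ : J₂ → SignType) (i : ν) (u : ν → ℝ) :
    (Q.branchSlope σ i).linear (0, u) =
      ∑ j, 2 * (Q.c j * Q.track j (0, u)) * Q.track j (0, Pi.single i 1) +
        ∑ j, 2 * (Q.d j * (σ j : ℝ) ^ 2 * Q.soft j (0, u)) * Q.soft j (0, Pi.single i 1) := by
  rw [branchSlope, AffineMap.add_linear, AffineMap.finsetSum_linear, AffineMap.finsetSum_linear]
  simp only [LinearMap.add_apply, LinearMap.sum_apply, AffineMap.smul_linear, LinearMap.smul_apply,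
    AffineMap.comp_linear, LinearMap.comp_apply, LinearMap.toAffineMap_linear, excessBranch_linear,
    smul_eq_mul]
  congr 1 <;> exact Finset.sum_congr rfl fun j _ => by ring

/-- Testing the linear part of the critical equations against `u` gives a sum of nonnegative terms
that contains all the tracking terms, because `u i` vanishes wherever a bound is active. -/
theorem criticalSystem_injective (σ : J₂ → SignType) (τ : ν → SignType) (η : ν → Bool)
    (u : ν → ℝ) (hu : (Q.criticalSystem σ τ η).linear (0, u) = 0) : u = 0 := by
  have hprod : ∀ i, u i * (Q.branchSlope σ i).linear (0, u) = 0 := by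
    intro i
    have hi := congrFun hu i
    change (Q.criticalEquation σ η i (τ i)).linear (0, u) = 0 at hi
    generalize τ i = s at hi
    rcases s with _ | _ | _
    · exact mul_eq_zero_of_right _ hi
    · exact mul_eq_zero_of_left (by simpa [criticalEquation] using hi) _
    · exact mul_eq_zero_of_left (by simpa [criticalEquation] using hi) _
  have hsum : ∑ i, u i * (Q.branchSlope σ i).linear (0, u) =
      ∑ j, 2 * (Q.c j * Q.track j (0, u) ^ 2) +
        ∑ j, 2 * (Q.d j * (σ j : ℝ) ^ 2 * Q.soft j (0, u) ^ 2) := by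
    simp only [branchSlope_linear, mul_add, Finset.mul_sum, Finset.sum_add_distrib]
    rw [Finset.sum_comm, Finset.sum_comm (s := Finset.univ (α := ν))]
    have hmul : ∀ (f : Z × (ν → ℝ) →ₗ[ℝ] ℝ) (a : ℝ),
        ∑ i, u i * (a * f (0, Pi.single i 1)) = a * f (0, u) := fun f a => by
      rw [← sum_mul_map_single f u, Finset.mul_sum]
      exact Finset.sum_congr rfl fun i _ => by ring
    simp only [hmul]
    congr 1 <;> exact Finset.sum_congr rfl fun j _ => by ring
  rw [Finset.sum_eq_zero fun i _ => hprod i] at hsum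
  have h1 : ∀ j ∈ Finset.univ, 0 ≤ 2 * (Q.c j * Q.track j (0, u) ^ 2) := fun j _ => by
    have := (Q.c_pos j).le
    positivity
  have h2 : 0 ≤ ∑ j, 2 * (Q.d j * (σ j : ℝ) ^ 2 * Q.soft j (0, u) ^ 2) :=
    Finset.sum_nonneg fun j _ => by
      have := (Q.d_pos j).le
      positivity
  have h3 : ∑ j, 2 * (Q.c j * Q.track j (0, u) ^ 2) = 0 :=
    le_antisymm (by linarith) (Finset.sum_nonneg h1)
  rw [Finset.sum_eq_zero_iff_of_nonneg h1] at h3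
  refine Q.eq_zero_of_track u fun j => ?_
  simpa [(Q.c_pos j).ne'] using h3 j (Finset.mem_univ j)

/-- The solution map of a soft box program is affine on each of finitely many polyhedral regions
covering the parameter space. -/
theorem exists_critical_regions {ι : Type*} [Fintype ι]
    (Q : SoftBoxProgram (EuclideanSpace ℝ ι) ν J₁ J₂) :
    ∃ (R : (J₂ → SignType) × (ν → SignType) × (ν → Bool) → Set (EuclideanSpace ℝ ι))
      (g : (J₂ → SignType) × (ν → SignType) × (ν → Bool) → EuclideanSpace ℝ ι →ᵃ[ℝ] (ν → ℝ)),
      (∀ ξ, IsPolyhedral (R ξ)) ∧ (∀ z, ∃ ξ, z ∈ R ξ) ∧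
        ∀ ξ, ∀ z ∈ R ξ, Q.IsMinimizer z (g ξ z) := by
  choose g hg using fun ξ : (J₂ → SignType) × (ν → SignType) × (ν → Bool) =>
    AffineMap.exists_eq_of_injective (Q.criticalSystem ξ.1 ξ.2.1 ξ.2.2)
      (Q.criticalSystem_injective ξ.1 ξ.2.1 ξ.2.2)
  -- On each region, the affine solution of the equations satisfies all first-order conditions.
  refine ⟨fun ξ => {z | Q.IsCritical ξ.1 ξ.2.1 ξ.2.2 z (g ξ z)}, g, ?_, fun z => ?_,
    fun ξ z hz => (Q.isMinimizer_iff_exists_isCritical z _).2 ⟨_, _, _, hz⟩⟩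
  · rintro ⟨σ, τ, η⟩
    set f := g (σ, τ, η)
    let pair : EuclideanSpace ℝ ι →ᵃ[ℝ] EuclideanSpace ℝ ι × (ν → ℝ) :=
      (AffineMap.id ℝ _).prod f
    have hle := isPolyhedral_setOf_le (ι := ι)
    have heq : ∀ p q : EuclideanSpace ℝ ι →ᵃ[ℝ] ℝ, IsPolyhedral {z | p z = q z} := fun p q => by
      simp only [le_antisymm_iff]
      exact (hle p q).setOf_and (hle q p)
    refine .setOf_and (.setOf_forall fun j => ?_) (.setOf_forall fun i => .setOf_and ?_ ?_)
    · let w := (Q.soft j).toAffineMap.comp pair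
      have h1 := hle w (AffineMap.const ℝ _ (Q.lo j))
      have h2 := hle (AffineMap.const ℝ _ (Q.lo j)) w
      have h3 := hle w (AffineMap.const ℝ _ (Q.hi j))
      have h4 := hle (AffineMap.const ℝ _ (Q.hi j)) w
      change IsPolyhedral {z | InBranch (Q.lo j) (Q.hi j) (w z) (σ j)}
      rcases σ j with _ | _ | _
      · exact h2.setOf_and h3
      · exact h1
      · exact h4
    · exact hle 0 (Q.signedRadius η i).toAffineMap
    · let t := (LinearMap.proj (R := ℝ) (φ := fun _ : ν => ℝ) i).toAffineMap.comp f
      let r := (Q.signedRadius η i).toAffineMap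
      let s := (Q.branchSlope σ i).comp pair
      change IsPolyhedral {z | CoordinateOptimal (t z) (r z) (s z) (τ i)}
      rcases τ i with _ | _ | _
      · exact (heq s 0).setOf_and ((hle (-r) t).setOf_and (hle t r))
      · exact (heq t (-r)).setOf_and (hle 0 s)
      · exact (heq t r).setOf_and (hle s 0)
  · obtain ⟨u, hu⟩ := Q.exists_isMinimizer z
    obtain ⟨σ, τ, η, h⟩ := (Q.isMinimizer_iff_exists_isCritical z u).1 hu
    refine ⟨(σ, τ, η), ?_⟩
    have := hg (σ, τ, η) z u h.criticalSystem_eq_zero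
    change Q.IsCritical σ τ η z (g (σ, τ, η) z)
    rwa [← this]

end SoftBoxProgram

/-! ### The Euler discretizations -/

section Euler

variable {n m N : ℕ} (G : PowerNetwork n m) (P : MPCParams n)

theorem modelA_mulVec_flow (x : State n m) (e : Fin m) :
    (modelA G P *ᵥ x) (Sum.inl e) = (G.incidence *ᵥ x.freq) e := by
  simp [modelA, Matrix.fromBlocks_mulVec, Matrix.fromCols_mulVec, Function.comp_def]
  rfl

theorem modelA_mulVec_freq (x : State n m) (i : Fin n) :
    (modelA G P *ᵥ x) (Sum.inr (Sum.inl i)) =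
      -(G.incidenceᵀ *ᵥ (fun e => G.b e * x (Sum.inl e))) i - G.E i * x.freq i + x.filt i := by
  simp [modelA, Matrix.fromBlocks_mulVec, Matrix.fromRows_mulVec, State.freq, State.filt,
    Function.comp_def, Matrix.neg_mulVec, ← Matrix.mulVec_mulVec, Matrix.mulVec_diagonal]
  rw [show (Matrix.diagonal G.b *ᵥ fun e => x (Sum.inl e)) = fun e => G.b e * x (Sum.inl e) from
    funext fun e => Matrix.mulVec_diagonal _ _ _]
  ring

theorem modelA_mulVec_filt (x : State n m) (i : Fin n) :
    (modelA G P *ᵥ x) (Sum.inr (Sum.inr i)) =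
      if i ∈ P.Iu then -x.freq i - 1 / P.τ i * x.filt i else -x.filt i := by
  simp [modelA, Matrix.fromBlocks_mulVec, Matrix.fromRows_mulVec, State.freq, State.filt,
    Function.comp_def, Matrix.mulVec_diagonal]
  split_ifs <;> ring

theorem modelB₂_mulVec (u : Fin n → ℝ) :
    modelB₂ m P *ᵥ u = Sum.elim (fun _ => 0)
      (Sum.elim (fun _ => 0) fun i => if i ∈ P.Iu then u i else 0) := by
  ext (e | i | i) <;> simp [modelB₂, Matrix.fromRows_mulVec, Matrix.mulVec_diagonal]

/-- An input that can be recognized from the filter states after a single step from the zero state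
can be recognized over the whole horizon. -/
theorem inputDistinguishable_of_step {P : MPCParams n}
    {F A : Matrix (StateIdx n m) (StateIdx n m) ℝ} {B₁ B₂ : Matrix (StateIdx n m) (Fin n) ℝ}
    (hN : 2 ≤ N) (h : ∀ (x : State n m), ∀ u ∈ Admissible P, F *ᵥ x = B₂ *ᵥ u →
      (∀ i ∈ P.Iu, x.filt i = 0) → u = 0) : InputDistinguishable P N F A B₁ B₂ := by
  intro X u hu hdyn hinit hfilt
  refine h _ u hu ?_ (hfilt ⟨0 + 1, hN⟩)
  rw [hdyn 0 hN, hinit]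
  simp

theorem IsForwardEuler.inputDistinguishable {G : PowerNetwork n m} {P : MPCParams n}
    {F A : Matrix (StateIdx n m) (StateIdx n m) ℝ} {B₁ B₂ : Matrix (StateIdx n m) (Fin n) ℝ}
    (hN : 2 ≤ N) (h : IsForwardEuler G P F B₂) : InputDistinguishable P N F A B₁ B₂ := by
  obtain ⟨rfl, rfl⟩ := h
  refine inputDistinguishable_of_step hN fun x u hu hstep hfilt => ?_
  rw [Matrix.smul_mulVec, modelB₂_mulVec] at hstep
  ext i
  by_cases hi : i ∈ P.Iu
  · have h1 := congrFun hstep (Sum.inr (Sum.inr i))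
    have h2 : x (Sum.inr (Sum.inr i)) = 0 := hfilt i hi
    simpa [modelG, Matrix.mulVec_diagonal, hi, h2, P.T_pos.ne'] using h1
  · exact hu i hi

/-- With the filter states at zero after one backward Euler step, the frequencies solve a linear
system whose matrix `M + T E + T² Dᵀ Y_b D` is positive definite.  They vanish, so the filter
equations reduce to `T u = 0`. -/
theorem IsBackwardEuler.inputDistinguishable {G : PowerNetwork n m} {P : MPCParams n}
    {F A : Matrix (StateIdx n m) (StateIdx n m) ℝ} {B₁ B₂ : Matrix (StateIdx n m) (Fin n) ℝ}
    (hN : 2 ≤ N) (h : IsBackwardEuler G P F B₂) : InputDistinguishable P N F A B₁ B₂ := by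
  obtain ⟨rfl, rfl⟩ := h
  refine inputDistinguishable_of_step hN fun x u hu hstep hfilt => ?_
  have hT := P.T_pos
  rw [Matrix.smul_mulVec, modelB₂_mulVec, Matrix.sub_mulVec, Matrix.smul_mulVec] at hstep
  have hα : ∀ i, x.filt i = 0 := by
    intro i
    by_cases hi : i ∈ P.Iu
    · exact hfilt i hi
    · have h1 := congrFun hstep (Sum.inr (Sum.inr i))
      simpa [modelG, Matrix.mulVec_diagonal, modelA_mulVec_filt, hi, hT.ne'] using h1
  have hflow : ∀ e, x (Sum.inl e) = P.T * (G.incidence *ᵥ x.freq) e := by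
    intro e
    have h1 := congrFun hstep (Sum.inl e)
    simp [modelG, Matrix.mulVec_diagonal, modelA_mulVec_flow] at h1
    linarith
  have hfreq : ∀ i, G.M i * x.freq i ^ 2 + P.T * (G.E i * x.freq i ^ 2) +
      P.T * (x.freq i * (G.incidenceᵀ *ᵥ (fun e => G.b e * x (Sum.inl e))) i) = 0 := by
    intro i
    have h1 := congrFun hstep (Sum.inr (Sum.inl i))
    simp only [modelG, Pi.sub_apply, Matrix.mulVec_diagonal, Sum.elim_inr, Sum.elim_inl,
      Pi.smul_apply, modelA_mulVec_freq, hα, smul_eq_mul, mul_zero] at h1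
    change G.M i * x.freq i - _ = 0 at h1
    linear_combination x.freq i * h1
  have hadj : ∑ i, x.freq i * (G.incidenceᵀ *ᵥ (fun e => G.b e * x (Sum.inl e))) i =
      P.T * ∑ e, G.b e * (G.incidence *ᵥ x.freq) e ^ 2 := by
    change x.freq ⬝ᵥ (G.incidenceᵀ *ᵥ _) = _
    rw [Matrix.dotProduct_mulVec, Matrix.vecMul_transpose, dotProduct, Finset.mul_sum]
    exact Finset.sum_congr rfl fun e _ => by rw [hflow]; ring
  have hsum := Finset.sum_eq_zero fun i (_ : i ∈ Finset.univ) => hfreq i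
  rw [Finset.sum_add_distrib, Finset.sum_add_distrib, ← Finset.mul_sum, ← Finset.mul_sum,
    hadj] at hsum
  have h1 : 0 ≤ ∑ i, G.M i * x.freq i ^ 2 :=
    Finset.sum_nonneg fun i _ => mul_nonneg (G.M_nonneg i) (sq_nonneg _)
  have h2 : 0 ≤ P.T * (P.T * ∑ e, G.b e * (G.incidence *ᵥ x.freq) e ^ 2) :=
    mul_nonneg hT.le (mul_nonneg hT.le
      (Finset.sum_nonneg fun e _ => mul_nonneg (G.b_pos e).le (sq_nonneg _)))
  have h3 : ∀ i ∈ Finset.univ, 0 ≤ G.E i * x.freq i ^ 2 :=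
    fun i _ => mul_nonneg (G.E_pos i).le (sq_nonneg _)
  have h4 : ∑ i, G.E i * x.freq i ^ 2 = 0 := by
    refine le_antisymm ?_ (Finset.sum_nonneg h3)
    by_contra! hpos
    linarith [mul_pos hT hpos]
  rw [Finset.sum_eq_zero_iff_of_nonneg h3] at h4
  have hω : ∀ i, x.freq i = 0 := fun i => by
    simpa [(G.E_pos i).ne'] using h4 i (Finset.mem_univ i)
  ext i
  by_cases hi : i ∈ P.Iu
  · have h5 := congrFun hstep (Sum.inr (Sum.inr i))
    have h6 : x (Sum.inr (Sum.inr i)) = 0 := hα i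
    simpa [modelG, Matrix.mulVec_diagonal, modelA_mulVec_filt, hi, hω, hα, h6, hT.ne'] using h5
  · exact hu i hi

end Euler

/-! ### Elimination of the trajectory and of the slack variables -/

section Reduction

variable {n m N : ℕ}

/-- The sampled state as a linear function of the parameter. -/
def sampledStateMap (n m N : ℕ) : EuclideanSpace ℝ (ParamIdx n m N) →ₗ[ℝ] State n m where
  toFun := sampledState
  map_add' _ _ := rfl
  map_smul' _ _ := rfl

/-- The forecast at position `k` of the horizon as a linear function of the parameter. -/
def forecastMap (n m N : ℕ) (k : Fin N) :
    EuclideanSpace ℝ (ParamIdx n m N) →ₗ[ℝ] (Fin n → ℝ) where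
  toFun z := forecast z k
  map_add' _ _ := rfl
  map_smul' _ _ := rfl

/-- The predicted state as a linear function of the parameter and the input.  Beyond the horizon,
where no forecast is available, the power injection is taken to be zero. -/
noncomputable def prediction (N : ℕ) (F A : Matrix (StateIdx n m) (StateIdx n m) ℝ)
    (B₁ B₂ : Matrix (StateIdx n m) (Fin n) ℝ) :
    ℕ → EuclideanSpace ℝ (ParamIdx n m N) × (Fin n → ℝ) →ₗ[ℝ] State n m
  | 0 => sampledStateMap n m N ∘ₗ LinearMap.fst ℝ _ _
  | k + 1 => F⁻¹.mulVecLin ∘ₗ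
      (A.mulVecLin ∘ₗ prediction N F A B₁ B₂ k +
        B₁.mulVecLin ∘ₗ (if h : k < N then forecastMap n m N ⟨k, h⟩ else 0) ∘ₗ
          LinearMap.fst ℝ _ _ +
        B₂.mulVecLin ∘ₗ LinearMap.snd ℝ _ _)

variable {F A : Matrix (StateIdx n m) (StateIdx n m) ℝ}
  {B₁ B₂ : Matrix (StateIdx n m) (Fin n) ℝ}

theorem dynamics_iff_eq_prediction (hF : IsUnit F) (z : EuclideanSpace ℝ (ParamIdx n m N))
    (X : Fin N → State n m) (u : Fin n → ℝ) :
    (Dynamics F A B₁ B₂ (forecast z) X u ∧ ∀ h : 0 < N, X ⟨0, h⟩ = sampledState z) ↔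
      ∀ k : Fin N, X k = prediction N F A B₁ B₂ k (z, u) := by
  have hdet : IsUnit F.det := (Matrix.isUnit_iff_isUnit_det F).1 hF
  have hsucc : ∀ (k : ℕ) (hk : k < N), prediction N F A B₁ B₂ (k + 1) (z, u) =
      F⁻¹ *ᵥ (A *ᵥ prediction N F A B₁ B₂ k (z, u) + B₁ *ᵥ forecast z ⟨k, hk⟩ + B₂ *ᵥ u) := by
    intro k hk
    simp only [prediction, hk, dite_true]
    rfl
  constructor
  · rintro ⟨hdyn, hinit⟩ ⟨k, hk⟩
    induction k with
    | zero => exact hinit hk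
    | succ k ih =>
      have hk' := Nat.lt_of_succ_lt hk
      change _ = prediction N F A B₁ B₂ (k + 1) (z, u)
      rw [hsucc k hk', ← ih hk', ← hdyn k hk, Matrix.mulVec_mulVec, Matrix.nonsing_inv_mul _ hdet,
        Matrix.one_mulVec]
  · intro h
    refine ⟨fun k hk => ?_, fun h0 => h ⟨0, h0⟩⟩
    rw [h, h]
    change F *ᵥ prediction N F A B₁ B₂ (k + 1) (z, u) = _
    rw [hsucc k (Nat.lt_of_succ_lt hk), Matrix.mulVec_mulVec, Matrix.mul_nonsing_inv _ hdet,
      Matrix.one_mulVec]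

/-- The program in the input alone that results from eliminating the trajectory and the slack
variables.  At an uncontrolled bus the radius is zero, which forces the input there to vanish, and
the input itself is tracked, so that the tracking terms determine all coordinates of the input. -/
noncomputable def reducedProgram (P : MPCParams n) (hN : 0 < N) (hF : IsUnit F)
    (hdist : InputDistinguishable P N F A B₁ B₂) :
    SoftBoxProgram (EuclideanSpace ℝ (ParamIdx n m N)) (Fin n) (Fin N × Fin n) (Fin N × P.Iw) where
  track q := if q.2 ∈ P.Iu
    then LinearMap.proj (Sum.inr (Sum.inr q.2)) ∘ₗ prediction N F A B₁ B₂ q.1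
    else LinearMap.proj q.2 ∘ₗ LinearMap.snd ℝ _ _
  c q := if q.2 ∈ P.Iu then P.c q.2 else 1
  soft q := LinearMap.proj (Sum.inr (Sum.inl q.2.1)) ∘ₗ prediction N F A B₁ B₂ q.1
  d q := P.d q.2
  lo q := P.wlo q.2
  hi q := P.whi q.2
  radius i := if i ∈ P.Iu
    then P.ε i • (LinearMap.proj (Sum.inr (Sum.inr i)) ∘ₗ sampledStateMap n m N) else 0
  c_pos q := by
    split_ifs with h
    · exact P.c_pos _ h
    · exact one_pos
  d_pos q := P.d_pos _ q.2.2
  lo_le_hi q := (P.wlo_lt_whi _ q.2.2).le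
  eq_zero_of_track u hu := by
    have hadm : u ∈ Admissible P := fun i hi => by simpa [hi] using hu (⟨0, hN⟩, i)
    obtain ⟨h1, h2⟩ := (dynamics_iff_eq_prediction (A := A) (B₁ := B₁) (B₂ := B₂) hF
      (0 : EuclideanSpace ℝ (ParamIdx n m N)) _ u).2 fun _ => rfl
    exact hdist _ u hadm h1 h2 fun k i hi => by
      simpa [hi, State.filt] using hu (k, i)

variable {P : MPCParams n} (hN : 0 < N) (hF : IsUnit F)
  (hdist : InputDistinguishable P N F A B₁ B₂)

theorem mem_box_reducedProgram (z : EuclideanSpace ℝ (ParamIdx n m N)) (u : Fin n → ℝ) :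
    u ∈ (reducedProgram P hN hF hdist).box z ↔
      u ∈ Admissible P ∧ ∀ i ∈ P.Iu, |u i| ≤ P.ε i * |(sampledState z).filt i| := by
  have hr : ∀ i, |(reducedProgram P hN hF hdist).radius i z| =
      if i ∈ P.Iu then P.ε i * |(sampledState z).filt i| else 0 := by
    intro i
    by_cases hi : i ∈ P.Iu
    · simp only [reducedProgram, hi, if_true]
      change |P.ε i * (sampledState z).filt i| = _
      rw [abs_mul, abs_of_pos (P.ε_pos i hi)]
    · simp [reducedProgram, hi]
  simp only [SoftBoxProgram.box, Set.mem_ofPred_eq, hr, Admissible]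
  constructor
  · intro h
    exact ⟨fun i hi => by simpa [hi] using h i, fun i hi => by simpa [hi] using h i⟩
  · rintro ⟨h1, h2⟩ i
    by_cases hi : i ∈ P.Iu
    · simpa [hi] using h2 i hi
    · simp [hi, h1 i hi]

/-- The decision determined by an input: the predicted trajectory and the cheapest slack. -/
noncomputable def inducedDecision (P : MPCParams n) (F A : Matrix (StateIdx n m) (StateIdx n m) ℝ)
    (B₁ B₂ : Matrix (StateIdx n m) (Fin n) ℝ) (z : EuclideanSpace ℝ (ParamIdx n m N))
    (u : Fin n → ℝ) : Decision n m N P where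
  X k := prediction N F A B₁ B₂ k (z, u)
  u := u
  S k i := |excess (P.wlo i) (P.whi i) (State.freq (prediction N F A B₁ B₂ k (z, u)) i)|

theorem objective_reducedProgram (z : EuclideanSpace ℝ (ParamIdx n m N)) {u : Fin n → ℝ}
    (hu : u ∈ Admissible P) :
    (reducedProgram P hN hF hdist).objective z u =
      cost (inducedDecision P F A B₁ B₂ z u) := by
  rw [SoftBoxProgram.objective, cost, Finset.sum_add_distrib, Fintype.sum_prod_type,
    Fintype.sum_prod_type]
  congr 1
  · refine Finset.sum_congr rfl fun k _ => ?_
    rw [← Finset.sum_subset (Finset.subset_univ P.Iu)]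
    · exact Finset.sum_congr rfl fun i hi => by
        simp [reducedProgram, hi, inducedDecision, State.filt]
    · intro i _ hi
      simp [reducedProgram, hi, hu i hi]
  · refine Finset.sum_congr rfl fun k _ => Finset.sum_congr rfl fun i _ => ?_
    simp [reducedProgram, inducedDecision, State.freq]

/-- A slack satisfying the soft constraint has square at least that of the excess, with equality
only for the least nonnegative slack. -/
theorem excess_sq_le_of_soft {lo hi t s : ℝ} (h : lo ≤ hi) (h1 : lo - s ≤ t) (h2 : t ≤ hi + s) :
    excess lo hi t ^ 2 ≤ s ^ 2 ∧ (s ^ 2 = excess lo hi t ^ 2 → s = |excess lo hi t|) := by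
  rcases excess_cases h t with ⟨h3, e⟩ | ⟨h3, h4, e⟩ | ⟨h3, e⟩ <;> rw [e]
  · refine ⟨by nlinarith, fun h5 => ?_⟩
    rw [← abs_of_nonneg (show 0 ≤ s by linarith)]
    exact (sq_eq_sq_iff_abs_eq_abs _ _).1 h5
  · exact ⟨by nlinarith [sq_nonneg s], fun h5 => by simpa using h5⟩
  · refine ⟨by nlinarith, fun h5 => ?_⟩
    rw [← abs_of_nonneg (show 0 ≤ s by linarith)]
    exact (sq_eq_sq_iff_abs_eq_abs _ _).1 h5

theorem isFeasible_inducedDecision {z : EuclideanSpace ℝ (ParamIdx n m N)} {u : Fin n → ℝ}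
    (hu : u ∈ (reducedProgram P hN hF hdist).box z) :
    IsFeasible F A B₁ B₂ z (inducedDecision P F A B₁ B₂ z u) := by
  obtain ⟨hadm, hbound⟩ := (mem_box_reducedProgram hN hF hdist z u).1 hu
  obtain ⟨hdyn, hinit⟩ := (dynamics_iff_eq_prediction (A := A) (B₁ := B₁) (B₂ := B₂) hF z
    (inducedDecision P F A B₁ B₂ z u).X u).2 fun _ => rfl
  refine ⟨hdyn, hadm, hinit, fun i k => ?_, hbound⟩
  change P.wlo i - |excess _ _ (((inducedDecision P F A B₁ B₂ z u).X k).freq i)| ≤ _ ∧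
    _ ≤ P.whi i + |excess _ _ (((inducedDecision P F A B₁ B₂ z u).X k).freq i)|
  generalize ((inducedDecision P F A B₁ B₂ z u).X k).freq i = t
  have habs := abs_le.1 (le_refl |excess (P.wlo i) (P.whi i) t|)
  have hlt := P.wlo_lt_whi i i.2
  rcases excess_cases hlt.le t with ⟨h3, e⟩ | ⟨h3, h4, e⟩ | ⟨h3, e⟩ <;> rw [e] at habs ⊢ <;>
    constructor <;> linarith

/-- The slack of a feasible decision costs at least as much as the cheapest slack, and no other slack
attains this cost. -/
theorem IsFeasible.cost_inducedDecision_le {z : EuclideanSpace ℝ (ParamIdx n m N)}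
    {y : Decision n m N P} (hF : IsUnit F) (hy : IsFeasible F A B₁ B₂ z y) :
    cost (inducedDecision P F A B₁ B₂ z y.u) ≤ cost y ∧
      (cost y = cost (inducedDecision P F A B₁ B₂ z y.u) →
        y = inducedDecision P F A B₁ B₂ z y.u) := by
  have hX : (inducedDecision P F A B₁ B₂ z y.u).X = y.X :=
    (funext ((dynamics_iff_eq_prediction hF z y.X y.u).1 ⟨hy.dynamics, hy.initial⟩)).symm
  have hS : ∀ k i, (inducedDecision P F A B₁ B₂ z y.u).S k i =
      |excess (P.wlo i) (P.whi i) ((y.X k).freq i)| := fun k i => by rw [← hX]; rfl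
  have hsoft := fun k (i : P.Iw) => excess_sq_le_of_soft (P.wlo_lt_whi i i.2).le
    (hy.soft_frequency i k).1 (hy.soft_frequency i k).2
  have hterm : ∀ q ∈ Finset.univ, P.d (q : Fin N × P.Iw).2 *
      (inducedDecision P F A B₁ B₂ z y.u).S q.1 q.2 ^ 2 ≤ P.d q.2 * y.S q.1 q.2 ^ 2 := by
    rintro ⟨k, i⟩ -
    rw [hS, sq_abs]
    exact mul_le_mul_of_nonneg_left (hsoft k i).1 (P.d_pos i i.2).le
  have hcost : ∀ y' : Decision n m N P, cost y' =
      ∑ k, ∑ i ∈ P.Iu, P.c i * (y'.X k).filt i ^ 2 +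
        ∑ q : Fin N × P.Iw, P.d q.2 * y'.S q.1 q.2 ^ 2 := fun y' => by
    rw [cost, Finset.sum_add_distrib, Fintype.sum_prod_type]
  rw [hcost, hcost, hX]
  refine ⟨add_le_add_right (Finset.sum_le_sum hterm) _, fun h => ?_⟩
  have heq := (Finset.sum_eq_sum_iff_of_le hterm).1 (add_left_cancel h).symm
  obtain ⟨X, u, S⟩ := y
  have hS' : S = (inducedDecision P F A B₁ B₂ z u).S := by
    ext k i
    have h1 := mul_left_cancel₀ (P.d_pos i i.2).ne' (heq (k, i) (Finset.mem_univ _))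
    rw [hS, sq_abs] at h1
    rw [hS]
    exact (hsoft k i).2 h1.symm
  change (inducedDecision P F A B₁ B₂ z u).X = X at hX
  rw [hS', ← hX]
  rfl

theorem isOptimal_iff (z : EuclideanSpace ℝ (ParamIdx n m N)) (y : Decision n m N P) :
    IsOptimal F A B₁ B₂ z y ↔
      (reducedProgram P hN hF hdist).IsMinimizer z y.u ∧
        y = inducedDecision P F A B₁ B₂ z y.u := by
  have hbox : ∀ {y : Decision n m N P}, IsFeasible F A B₁ B₂ z y →
      y.u ∈ (reducedProgram P hN hF hdist).box z := fun hy =>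
    (mem_box_reducedProgram hN hF hdist z _).2 ⟨hy.admissible, hy.input_bound⟩
  have hobj : ∀ {u}, u ∈ (reducedProgram P hN hF hdist).box z →
      (reducedProgram P hN hF hdist).objective z u = cost (inducedDecision P F A B₁ B₂ z u) :=
    fun hu => objective_reducedProgram hN hF hdist z
      ((mem_box_reducedProgram hN hF hdist z _).1 hu).1
  constructor
  · rintro ⟨hy, hmin⟩
    obtain ⟨hle, heq⟩ := hy.cost_inducedDecision_le hF
    refine ⟨⟨hbox hy, fun v hv => ?_⟩, heq (le_antisymm ?_ hle)⟩
    · rw [hobj (hbox hy), hobj hv]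
      exact hle.trans (hmin _ (isFeasible_inducedDecision hN hF hdist hv))
    · exact hmin _ (isFeasible_inducedDecision hN hF hdist (hbox hy))
  · rintro ⟨hmin, hy⟩
    refine ⟨?_, fun y' hy' => ?_⟩
    · rw [hy]
      exact isFeasible_inducedDecision hN hF hdist hmin.1
    · have h1 := hmin.2 _ (hbox hy')
      rw [hobj hmin.1, hobj (hbox hy'), ← hy] at h1
      exact h1.trans (hy'.cost_inducedDecision_le hF).1

end Reduction

theorem mainTheorem2 {n m N : ℕ} (hN : 2 ≤ N) (G : PowerNetwork n m) (P : MPCParams n)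
    (F A : Matrix (StateIdx n m) (StateIdx n m) ℝ)
    (B₁ B₂ : Matrix (StateIdx n m) (Fin n) ℝ)
    (hF : IsUnit F)
    (hdisc : IsBackwardEuler G P F B₂ ∨ IsForwardEuler G P F B₂ ∨
      InputDistinguishable P N F A B₁ B₂) :
    (∀ z : EuclideanSpace ℝ (ParamIdx n m N),
      ∃! y : Decision n m N P, IsOptimal F A B₁ B₂ z y) ∧
    ∃ uOpt : EuclideanSpace ℝ (ParamIdx n m N) → EuclideanSpace ℝ (Fin n),
      (∀ (z : EuclideanSpace ℝ (ParamIdx n m N)) (y : Decision n m N P),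
        IsOptimal F A B₁ B₂ z y → uOpt z = WithLp.toLp 2 y.u) ∧
      Continuous uOpt ∧
      ∃ (l : ℕ) (r : Fin l → ℕ)
        (H : ∀ ξ : Fin l, Matrix (Fin (r ξ)) (ParamIdx n m N) ℝ)
        (h : ∀ ξ : Fin l, Fin (r ξ) → ℝ)
        (K : Fin l → Matrix (Fin n) (ParamIdx n m N) ℝ)
        (k : Fin l → Fin n → ℝ),
        (∀ z, ∃ ξ, z ∈ polyhedron (H ξ) (h ξ)) ∧
        (∀ ξ, ∀ z ∈ polyhedron (H ξ) (h ξ),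
          uOpt z = WithLp.toLp 2 (K ξ *ᵥ z.ofLp + k ξ)) ∧
        LipschitzWith (Finset.univ.sup fun ξ => ‖K ξ‖₊) uOpt := by
  have hdist : InputDistinguishable P N F A B₁ B₂ := by
    rcases hdisc with h | h | h
    · exact h.inputDistinguishable hN
    · exact h.inputDistinguishable hN
    · exact h
  have hN0 : 0 < N := by omega
  let Q := reducedProgram P hN0 hF hdist
  choose u hu using Q.exists_isMinimizer
  have hopt : ∀ z y, IsOptimal F A B₁ B₂ z y ↔ y = inducedDecision P F A B₁ B₂ z (u z) := by
    intro z y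
    rw [isOptimal_iff hN0 hF hdist]
    constructor
    · rintro ⟨h1, h2⟩
      rw [h2, (hu z).unique h1]
    · rintro rfl
      exact ⟨hu z, rfl⟩
  refine ⟨fun z => ⟨_, (hopt z _).2 rfl, fun y hy => (hopt z y).1 hy⟩,
    fun z => WithLp.toLp 2 (u z), fun z y hy => ?_, ?_⟩
  · rw [(hopt z y).1 hy]
    rfl
  · obtain ⟨R, g, hR, hcov, hg⟩ := Q.exists_critical_regions
    exact piecewise_affine_of_polyhedral_cover _ hR hcov g fun ξ z hz => by
      rw [(hu z).unique (hg ξ z hz)]
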